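/- Let $q\ge 2$, and let $M_0=I,M_1,\dots,M_{q^2-1}$ be $q\times q$ complex matrices with $\operatorname{tr}(M_i^\dagger M_j)=q\,\delta_{ij}$. For $\mathbf x\in\{0,\dots,q^2-1\}^n$ put $M_{\mathbf x}=M_{x_1}\otimes\cdots\otimes M_{x_n}$, $\operatorname{supp}(\mathbf x)=\{i:x_i\ne0\}$ and $|\mathbf x|=|\operatorname{supp}(\mathbf x)|$. Consider a variational circuit $U(\theta)$ on $n$ qudits of local dimension $q$, with parameters $\theta\in[0,2\pi]^p$, consisting of entangling gates and parameterized gates. Each entangling gate acts on two distinct (possibly non-adjacent) qudits, and each qudit is acted on by at least one entangling gate; the entangling gates are drawn independently, each from a probability measure on $\mathrm U(q^2)$ that is a unitary 2-design. Each entangling gate may be preceded and succeeded by any number of parameterized gates acting on one or both of its two qudits, and there are no other parameterized gates. A parameterized gate has the form $W_l\,e^{-iA\theta_j}\,W_r$, where $W_l,W_r$ are fixed unitaries, $A$ is Hermitian, $e^{-iA\theta}$ is $2\pi$-periodic in $\theta$, and $\theta_j$ is one of the parameters. Let $d$ be the entangling depth, i.e. the least number of layers of parallel gates into which the entangling gates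 can be arranged (the parameterized gates being removed). Let $\mathrm{gates}(\mathbf x)$ be the number of entangling gates acting between $\operatorname{supp}(\mathbf x)$ and its complement. Finally let $$g_{\mathbf x}=\mathbb E_V\,\mathbb E_\theta\,\bigl|\langle 0^n|U(\theta)^\dagger M_{\mathbf x}U(\theta)|0^n\rangle\bigr|^2,$$ where $\mathbb E_V$ averages over the entangling gates and $\theta$ is uniform on $[0,2\pi]^p$. There is a universal constant $K>0$ (independent of $q$, $n$, $p$, the matrices $M_i$, the circuit and $\mathbf x$) such that always $$g_{\mathbf x}\ \ge\ \max\bigl(q^{-K\,d\,|\mathbf x|},\ (q+1)^{-n}\bigr).$$ More precisely, $$g_{\mathbf x}\ \ge\ \max\bigl((q+1)^{-|\mathbf x|}(q^2+1)^{-\mathrm{gates}(\mathbf x)},\ (q+1)^{-n}\bigr)\qquad\text{and}\qquad \mathrm{gates}(\mathbf x)\le d\,|\mathbf x|.$$ -/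

import Mathlib

open Matrix MeasureTheory ProbabilityTheory

noncomputable section

/-! ### Unitary 2-designs on two qudits -/

/-- Matrices on two qudits of local dimension `q`. -/
abbrev TwoSite (q : ℕ) : Type := Matrix (Fin q × Fin q) (Fin q × Fin q) ℂ

/-- The unitary group `U(q²)`, acting on `ℂ^q ⊗ ℂ^q`. -/
abbrev U2 (q : ℕ) : Type := unitaryGroup (Fin q × Fin q) ℂ

instance instMeasurableSpaceU2 (q : ℕ) : MeasurableSpace (U2 q) := borel (U2 q)

instance instBorelSpaceU2 (q : ℕ) : BorelSpace (U2 q) := ⟨rfl⟩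

instance instCompactSpaceU2 (q : ℕ) : CompactSpace (U2 q) := by
  have hK : IsCompact (Set.univ.pi fun _ : Fin q × Fin q => Set.univ.pi
      fun _ : Fin q × Fin q => Metric.closedBall (0 : ℂ) 1) :=
    isCompact_univ_pi fun _ => isCompact_univ_pi fun _ => isCompact_closedBall 0 1
  have hC : IsClosed (unitaryGroup (Fin q × Fin q) ℂ : Set (TwoSite q)) := by
    have h : (unitaryGroup (Fin q × Fin q) ℂ : Set (TwoSite q)) = {A | A * star A = 1} := by
      ext A
      exact mem_unitaryGroup_iff
    rw [h]
    exact isClosed_eq (continuous_id.mul continuous_star) continuous_const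
  refine isCompact_iff_compactSpace.mp (hK.of_isClosed_subset hC ?_)
  intro A hA i _ j _
  simpa using entry_norm_bound_of_unitary hA i j

/-- The Haar probability measure on `U(q²)`. -/
def haarU2 (q : ℕ) : Measure (U2 q) := Measure.haarMeasure ⊤

/-- A probability measure on `U(q²)` is a (unitary) 2-design if its moments
`E[U ⊗ U ⊗ Ū ⊗ Ū]` agree, entry by entry, with those of the Haar probability measure. -/
def IsTwoDesign {q : ℕ} (μ : Measure (U2 q)) : Prop :=
  IsProbabilityMeasure μ ∧
    ∀ a a' b b' c c' d d' : Fin q × Fin q,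
      ∫ U : U2 q, (U : TwoSite q) a a' * (U : TwoSite q) b b' *
          star ((U : TwoSite q) c c') * star ((U : TwoSite q) d d') ∂μ =
        ∫ U : U2 q, (U : TwoSite q) a a' * (U : TwoSite q) b b' *
          star ((U : TwoSite q) c c') * star ((U : TwoSite q) d d') ∂(haarU2 q)

/-! ### Architectures of entangling gates -/

/-- The architecture of the entangling gates on `n` sites: `m` gates in order of application,
the `t`-th one acting on two distinct (possibly non-adjacent) sites. Every site is acted on
at least once. -/
structure Architecture (n : ℕ) where
  m : ℕ
  site₁ : Fin m → Fin n
  site₂ : Fin m → Fin n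
  site_ne : ∀ t, site₁ t ≠ site₂ t
  covers : ∀ i, ∃ t, site₁ t = i ∨ site₂ t = i

/-- Gates `s` and `t` act on a common site. -/
def Architecture.Overlap {n : ℕ} (A : Architecture n) (s t : Fin A.m) : Prop :=
  A.site₁ s = A.site₁ t ∨ A.site₁ s = A.site₂ t ∨ A.site₂ s = A.site₁ t ∨ A.site₂ s = A.site₂ t

/-- The gates can be arranged in `k` layers of parallel gates: gates of one layer act on disjoint
pairs of sites, and the order of the gates that share a site is respected. -/
def Architecture.HasLayering {n : ℕ} (A : Architecture n) (k : ℕ) : Prop :=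
  ∃ layer : Fin A.m → Fin k, ∀ s t, s < t → A.Overlap s t → layer s < layer t

/-- The entangling depth: the least number of layers of parallel entangling gates. -/
def Architecture.depth {n : ℕ} (A : Architecture n) : ℕ := sInf {k | A.HasLayering k}

/-- A set of layers exists: one gate per layer. -/
theorem Architecture.hasLayering_m {n : ℕ} (A : Architecture n) : A.HasLayering A.m :=
  ⟨id, fun _ _ h _ => h⟩

/-! ### Operators on `n` qudits -/

/-- Operators on `n` qudits of local dimension `q`, in the computational basis. -/
abbrev QuditOp (n q : ℕ) : Type := Matrix (Fin n → Fin q) (Fin n → Fin q) ℂ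

/-- The two-site operator `G` acting on sites `i` and `j` (first tensor factor on `i`), tensored
with the identity on the other sites. -/
def onSites {n q : ℕ} (i j : Fin n) (G : TwoSite q) : QuditOp n q :=
  Matrix.of fun s t => if ∀ k, k ≠ i → k ≠ j → s k = t k then G (s i, s j) (t i, t j) else 0

/-- `M : Fin (q ^ 2) → ℂ^{q × q}` is an orthogonal basis with `M 0 = I` and
`tr (M_i† M_j) = q δ_{ij}` (`q²` nonzero orthogonal elements are a basis of `ℂ^{q × q}`). -/
structure IsOperatorBasis {q : ℕ} [NeZero q]
    (M : Fin (q ^ 2) → Matrix (Fin q) (Fin q) ℂ) : Prop where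
  zero : M 0 = 1
  trace : ∀ i j, ((M i)ᴴ * M j).trace = if i = j then (q : ℂ) else 0

/-- `M_x = M_{x_1} ⊗ ⋯ ⊗ M_{x_n}`. -/
def tensorOp {n q : ℕ} (M : Fin (q ^ 2) → Matrix (Fin q) (Fin q) ℂ) (x : Fin n → Fin (q ^ 2)) :
    QuditOp n q :=
  Matrix.of fun s t => ∏ i, M (x i) (s i) (t i)

/-- The support of `x`: the sites at which `x` is nonzero. -/
def support {n q : ℕ} [NeZero q] (x : Fin n → Fin (q ^ 2)) : Finset (Fin n) :=
  Finset.univ.filter fun i => x i ≠ 0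

/-- The number of entangling gates that act between `S` and its complement. -/
def Architecture.gates {n : ℕ} (A : Architecture n) (S : Finset (Fin n)) : ℕ :=
  (Finset.univ.filter fun t => ¬ (A.site₁ t ∈ S ↔ A.site₂ t ∈ S)).card

/-! ### The variational circuit -/

/-- A parameterized gate `W_l e^{-i A θ} W_r` with `A` Hermitian, `W_l`, `W_r` fixed unitaries, and
`e^{-i A θ}` periodic in `θ` with period `2π`. It is placed next to an entangling gate and acts on
one or both of the two sites of that gate (a one-site gate is a two-site gate that is trivial on
the other tensor factor). Its parameter is the one with index `param` among the `p` parameters. -/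
structure ParamGate (q p : ℕ) where
  A : TwoSite q
  hermitian : A.IsHermitian
  periodic : Function.Periodic
    (fun θ : ℝ => NormedSpace.exp ((-(Complex.I * (θ : ℂ))) • A)) (2 * Real.pi)
  Wl : U2 q
  Wr : U2 q
  param : Fin p

/-- The unitary performed by a parameterized gate at the parameter values `θ`. -/
def ParamGate.mat {q p : ℕ} (g : ParamGate q p) (θ : Fin p → ℝ) : TwoSite q :=
  (g.Wl : TwoSite q) * NormedSpace.exp ((-(Complex.I * (θ g.param : ℂ))) • g.A) *
    (g.Wr : TwoSite q)

/-- The product of a list of parameterized gates that is given in order of application. -/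
def paramSeq {q p : ℕ} (l : List (ParamGate q p)) (θ : Fin p → ℝ) : TwoSite q :=
  (l.map fun g => g.mat θ).reverse.prod

/-- A hardware-efficient ansatz on `n` qudits of local dimension `q` with `p` parameters. Removing
the parameterized gates leaves the underlying architecture. The `t`-th entangling gate is preceded
by the parameterized gates `pre t` and succeeded by the parameterized gates `post t` on its two
sites (lists in order of application). The entangling gates are drawn independently, the `t`-th one
from the 2-design `law t`. -/
structure Ansatz (n q p : ℕ) extends Architecture n where
  pre : Fin m → List (ParamGate q p)
  post : Fin m → List (ParamGate q p)
  law : Fin m → Measure (U2 q)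
  law_design : ∀ t, IsTwoDesign (law t)

/-- The circuit unitary `U(θ)` for the realization `V` of the entangling gates. -/
def Ansatz.circuit {n q p : ℕ} (C : Ansatz n q p) (V : Fin C.m → U2 q) (θ : Fin p → ℝ) :
    QuditOp n q :=
  (List.ofFn fun t => onSites (C.site₁ t) (C.site₂ t)
    (paramSeq (C.post t) θ * (V t : TwoSite q) * paramSeq (C.pre t) θ)).reverse.prod

/-- The uniform distribution on the feasible set `[0, 2π]^p`. -/
def uniformParams (p : ℕ) : Measure (Fin p → ℝ) :=
  ProbabilityTheory.cond volume (Set.Icc 0 fun _ => 2 * Real.pi)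

/-- `g_x = E_V E_θ |⟨0^n| U(θ)† M_x U(θ) |0^n⟩|²`. -/
def Ansatz.g {n q p : ℕ} [NeZero q] (C : Ansatz n q p)
    (M : Fin (q ^ 2) → Matrix (Fin q) (Fin q) ℂ) (x : Fin n → Fin (q ^ 2)) : ℝ :=
  ∫ V : Fin C.m → U2 q, ∫ θ : Fin p → ℝ,
      ‖((C.circuit V θ)ᴴ * tensorOp M x * C.circuit V θ) 0 0‖ ^ 2
    ∂(uniformParams p) ∂(Measure.pi C.law)

end

/-!
Averaging one entangling gate over a 2-design sends `|tr (B U† M_k U)|²`, for `k ≠ 0`, to its mean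
over the nonzero labels `k`: a bilinear form on matrices that is invariant under unitary conjugation
is a combination of `tr (B C)` and `tr B tr C`, which leaves two constants to be computed.
Hence `g_x` is the mean of `∏ᵢ |⟨0|M_{yᵢ}|0⟩|²` over a Markov chain `y` on labels started at `x`, in
which each gate replaces a nonzero pair of labels by a uniformly random nonzero pair, independently
of the parameters. Every site is touched by some gate, which leaves its label, if nonzero, uniform
on the nonzero labels; so each factor with `yᵢ ≠ 0` may be replaced by its mean `1 / (q + 1)` over
these, and the product by `(q + 1)^(-|supp y|)`. This function never falls below `(q + 1)^(-n)` and
does not increase with the support. A gate with both sites inside or both outside the support does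
not enlarge it, and a gate that crosses its boundary keeps it within the old support with
probability `(q² - 1) / (q⁴ - 1) = 1 / (q² + 1)`.
-/

open Function (update)
open scoped BigOperators Kronecker
open Unitary (conjStarAlgAut conjStarAlgAut_apply conjStarAlgAut_mul_apply)

/-! ### Averages over nonzero labels -/

section NonzeroAverage

variable {β γ : Type*} [Fintype β] [DecidableEq β] [Zero β]

/-- The conditional expectation of `f` given whether `b = 0`, for `b` uniformly distributed. -/
noncomputable def nonzeroAvg (f : β → ℝ) (b : β) : ℝ :=
  if b = 0 then f 0 else 𝔼 c with c ≠ 0, f c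

@[simp]
theorem nonzeroAvg_zero (f : β → ℝ) : nonzeroAvg f 0 = f 0 := if_pos rfl

theorem nonzeroAvg_of_ne_zero (f : β → ℝ) {b : β} (hb : b ≠ 0) :
    nonzeroAvg f b = 𝔼 c with c ≠ 0, f c := if_neg hb

theorem sum_eq_zero_add_sum_ne_zero (f : β → ℝ) : ∑ c, f c = f 0 + ∑ c with c ≠ 0, f c := by
  simp [← Finset.sum_filter_add_sum_filter_not Finset.univ (· = (0 : β)), Finset.filter_eq']

theorem sum_nonzeroAvg (f : β → ℝ) : ∑ b, nonzeroAvg f b = ∑ b, f b := by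
  have h : ∑ b with b ≠ 0, nonzeroAvg f b = ∑ b with b ≠ 0, f b := by
    rw [← Finset.card_smul_expect _ f, ← Finset.sum_const]
    exact Finset.sum_congr rfl fun b hb => nonzeroAvg_of_ne_zero f (Finset.mem_filter.mp hb).2
  rw [sum_eq_zero_add_sum_ne_zero, h, nonzeroAvg_zero, ← sum_eq_zero_add_sum_ne_zero]

theorem nonzeroAvg_eq_of_sum_eq {f g : β → ℝ} (h₀ : f 0 = g 0) (h : ∑ b, f b = ∑ b, g b) :
    nonzeroAvg f = nonzeroAvg g := by
  rw [sum_eq_zero_add_sum_ne_zero, sum_eq_zero_add_sum_ne_zero g, h₀, add_right_inj] at h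
  ext b
  simp only [nonzeroAvg, Finset.expect, h₀, h]

theorem nonzeroAvg_mul_const (f : β → ℝ) (c : ℝ) (b : β) :
    nonzeroAvg (fun a => f a * c) b = nonzeroAvg f b * c := by
  simp only [nonzeroAvg, ite_mul, Finset.expect_mul]

theorem le_nonzeroAvg {f : β → ℝ} {c : ℝ} (h : ∀ a, c ≤ f a) (b : β) : c ≤ nonzeroAvg f b := by
  by_cases hb : b = 0
  · simpa [hb] using h 0
  · rw [nonzeroAvg_of_ne_zero f hb]
    exact Finset.le_expect ⟨b, by simpa using hb⟩ fun a _ => h a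

theorem nonzeroAvg_le_nonzeroAvg {f g : β → ℝ} (hfg : ∀ c, f c ≤ g c) (hf : ∀ c, f c ≤ f 0)
    {a b : β} (hab : b = 0 → a = 0) : nonzeroAvg f b ≤ nonzeroAvg g a := by
  by_cases hb : b = 0
  · simpa [hb, hab hb] using hfg 0
  rw [nonzeroAvg_of_ne_zero f hb]
  by_cases ha : a = 0
  · rw [ha, nonzeroAvg_zero]
    exact Finset.expect_le ⟨b, by simpa using hb⟩ fun c _ => (hf c).trans (hfg 0)
  · rw [nonzeroAvg_of_ne_zero g ha]
    exact Finset.expect_le_expect fun c _ => hfg c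

theorem integral_nonzeroAvg {X : Type*} [MeasurableSpace X] {μ : Measure X} {F : X → β → ℝ}
    (hF : ∀ b, Integrable (fun x => F x b) μ) (b : β) :
    ∫ x, nonzeroAvg (F x) b ∂μ = nonzeroAvg (fun c => ∫ x, F x c ∂μ) b := by
  by_cases hb : b = 0
  · simp [hb]
  · simp only [nonzeroAvg_of_ne_zero _ hb, Finset.expect_eq_sum_div_card]
    rw [integral_div, integral_finsetSum _ fun c _ => hF c]

theorem mul_le_nonzeroAvg_of_injective {F : β × β → ℝ} (hF : ∀ p, 0 ≤ F p) {e : β → β × β}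
    (he : Function.Injective e) (he₀ : e 0 = 0) {c : ℝ} (hc : ∀ a, c ≤ F (e a)) {p : β × β}
    (hp : p ≠ 0) : 1 / ((Fintype.card β : ℝ) + 1) * c ≤ nonzeroAvg F p := by
  have hcard (δ : Type _) [Fintype δ] [DecidableEq δ] [Zero δ] :
      ((Finset.univ.filter fun d : δ => d ≠ 0).card : ℝ) = Fintype.card δ - 1 := by
    rw [Finset.filter_ne', Finset.card_erase_of_mem (Finset.mem_univ _), Finset.card_univ,
      Nat.cast_pred Fintype.card_pos]
  have hcard_gt : (1 : ℝ) < Fintype.card β := by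
    have : Nontrivial β := not_subsingleton_iff_nontrivial.mp fun _ => hp (Subsingleton.elim _ _)
    exact_mod_cast Fintype.one_lt_card
  have hsum : ((Fintype.card β : ℝ) - 1) * c ≤ ∑ r with r ≠ 0, F r := by
    rw [← hcard β, ← nsmul_eq_mul, ← Finset.sum_const]
    calc ∑ a : β with a ≠ 0, c ≤ ∑ a : β with a ≠ 0, F (e a) := Finset.sum_le_sum fun a _ => hc a
      _ = ∑ r ∈ (Finset.univ.filter fun a : β => a ≠ 0).map ⟨e, he⟩, F r := by
          rw [Finset.sum_map]; rfl
      _ ≤ ∑ r with r ≠ 0, F r := Finset.sum_le_sum_of_subset_of_nonneg (fun r hr => by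
          obtain ⟨a, ha, rfl⟩ := Finset.mem_map.mp hr
          simpa [← he₀] using he.ne (Finset.mem_filter.mp ha).2) fun r _ _ => hF r
  rw [nonzeroAvg_of_ne_zero F hp, Finset.expect_eq_sum_div_card, hcard, Fintype.card_prod,
    Nat.cast_mul, le_div_iff₀ (by nlinarith)]
  refine le_of_eq_of_le ?_ hsum
  field_simp
  ring

variable [Fintype γ] [DecidableEq γ] [Zero γ]

theorem nonzeroAvg_comm (F : β → γ → ℝ) (b : β) (c : γ) :
    nonzeroAvg (fun b' => nonzeroAvg (F b') c) b =
      nonzeroAvg (fun c' => nonzeroAvg (fun b' => F b' c') b) c := by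
  by_cases hb : b = 0 <;> by_cases hc : c = 0 <;>
    simp only [hb, hc, nonzeroAvg_zero, nonzeroAvg_of_ne_zero, ne_eq, not_false_eq_true]
  exact Finset.expect_comm _ _ _

theorem nonzeroAvg_nonzeroAvg_fst (F : β × γ → ℝ) :
    nonzeroAvg (fun p : β × γ => nonzeroAvg (fun b => F (b, p.2)) p.1) = nonzeroAvg F := by
  refine nonzeroAvg_eq_of_sum_eq (by simp [Prod.mk_zero_zero]) ?_
  simp only [Fintype.sum_prod_type_right, sum_nonzeroAvg]

theorem nonzeroAvg_nonzeroAvg_snd (F : β × γ → ℝ) :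
    nonzeroAvg (fun p : β × γ => nonzeroAvg (fun c => F (p.1, c)) p.2) = nonzeroAvg F := by
  refine nonzeroAvg_eq_of_sum_eq (by simp [Prod.mk_zero_zero]) ?_
  simp only [Fintype.sum_prod_type, sum_nonzeroAvg]

end NonzeroAverage

/-! ### The Markov chain on strings -/

section Strings

variable {ι α : Type*} [DecidableEq ι] [Fintype α] [DecidableEq α] [Zero α]

/-- The average of `f` over the strings obtained from `x` by resampling its letter at `k`. A zero
letter stays zero, a nonzero letter becomes uniform on the nonzero letters. -/
noncomputable def siteAvg (k : ι) (f : (ι → α) → ℝ) (x : ι → α) : ℝ :=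
  nonzeroAvg (fun a => f (update x k a)) (x k)

/-- The average of `f` over the strings obtained from `x` by resampling the pair of its letters at
`i` and `j`. The pair `(0, 0)` stays put, any other pair becomes uniform on the nonzero pairs. -/
noncomputable def gateAvg (i j : ι) (f : (ι → α) → ℝ) (x : ι → α) : ℝ :=
  nonzeroAvg (fun p : α × α => f (update (update x i p.1) j p.2)) (x i, x j)

/-- The average of `f` over the Markov chain on strings started at the argument, which resamples
the pairs of letters `g (m - 1)`, ..., `g 0` in this order. -/
noncomputable def evolve : {m : ℕ} → (Fin m → ι × ι) → ((ι → α) → ℝ) → (ι → α) → ℝ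
  | 0, _, f => f
  | m + 1, g, f => gateAvg (g (Fin.last m)).1 (g (Fin.last m)).2
      (evolve (fun t : Fin m => g t.castSucc) f)

theorem gateAvg_siteAvg_left {i j : ι} (hij : i ≠ j) (f : (ι → α) → ℝ) :
    gateAvg i j (siteAvg i f) = gateAvg i j f := by
  ext x
  simp only [gateAvg, siteAvg, Function.update_comm hij, Function.update_self,
    Function.update_idem]
  exact congrFun (nonzeroAvg_nonzeroAvg_fst
    fun p : α × α => f (update (update x j p.2) i p.1)) _

theorem gateAvg_siteAvg_right (i j : ι) (f : (ι → α) → ℝ) :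
    gateAvg i j (siteAvg j f) = gateAvg i j f := by
  ext x
  simp only [gateAvg, siteAvg, Function.update_self, Function.update_idem]
  exact congrFun (nonzeroAvg_nonzeroAvg_snd
    fun p : α × α => f (update (update x i p.1) j p.2)) _

theorem gateAvg_siteAvg_comm {i j k : ι} (hi : i ≠ k) (hj : j ≠ k) (f : (ι → α) → ℝ) :
    gateAvg i j (siteAvg k f) = siteAvg k (gateAvg i j f) := by
  ext x
  simp only [gateAvg, siteAvg, Function.update_of_ne hi, Function.update_of_ne hj,
    Function.update_of_ne hi.symm, Function.update_of_ne hj.symm, Function.update_comm hj,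
    Function.update_comm hi]
  exact nonzeroAvg_comm _ _ _

theorem evolve_siteAvg_comm {m : ℕ} {g : Fin m → ι × ι} {k : ι}
    (hk : ∀ t, (g t).1 ≠ k ∧ (g t).2 ≠ k) (f : (ι → α) → ℝ) :
    evolve g (siteAvg k f) = siteAvg k (evolve g f) := by
  induction m with
  | zero => rfl
  | succ m ih => rw [evolve, ih fun t => hk _, gateAvg_siteAvg_comm (hk _).1 (hk _).2, evolve]

/-- The first gate of the circuit that touches `k` already resamples the letter there. -/
theorem evolve_siteAvg {m : ℕ} {g : Fin m → ι × ι} (hne : ∀ t, (g t).1 ≠ (g t).2) {k : ι}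
    (hk : ∃ t, (g t).1 = k ∨ (g t).2 = k) (f : (ι → α) → ℝ) :
    evolve g (siteAvg k f) = evolve g f := by
  induction m with
  | zero => exact hk.choose.elim0
  | succ m ih =>
    by_cases h : ∃ t : Fin m, (g t.castSucc).1 = k ∨ (g t.castSucc).2 = k
    · rw [evolve, ih (fun t => hne _) h, evolve]
    push Not at h
    have hlast : (g (Fin.last m)).1 = k ∨ (g (Fin.last m)).2 = k := by
      obtain ⟨t, ht⟩ := hk
      induction t using Fin.lastCases with
      | last => exact ht
      | cast t => exact absurd ht (not_or.mpr (h t))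
    rw [evolve, evolve_siteAvg_comm h, evolve]
    rcases hlast with rfl | rfl
    · exact gateAvg_siteAvg_left (hne _) _
    · exact gateAvg_siteAvg_right _ _ _

theorem siteAvg_prod [Fintype ι] (w : ι → α → ℝ) (k : ι) :
    siteAvg k (fun x => ∏ i, w i (x i)) =
      fun x => ∏ i, update w k (nonzeroAvg (w k)) i (x i) := by
  ext x
  simp only [siteAvg, Function.apply_update w, Function.apply_update (fun i (v : α → ℝ) => v (x i)),
    Finset.prod_update_of_mem (Finset.mem_univ k), nonzeroAvg_mul_const]

theorem evolve_prod [Fintype ι] {m : ℕ} {g : Fin m → ι × ι} (hne : ∀ t, (g t).1 ≠ (g t).2)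
    (hcov : ∀ k, ∃ t, (g t).1 = k ∨ (g t).2 = k) (w : ι → α → ℝ) :
    evolve g (fun x => ∏ i, w i (x i)) = evolve g fun x => ∏ i, nonzeroAvg (w i) (x i) := by
  have h (S : Finset ι) : evolve g (fun x => ∏ i, w i (x i)) =
      evolve g fun x => ∏ i, S.piecewise (fun i => nonzeroAvg (w i)) w i (x i) := by
    induction S using Finset.induction_on with
    | empty => simp
    | insert k S hk ih =>
      rw [ih, ← evolve_siteAvg hne (hcov k), siteAvg_prod, Finset.piecewise_insert,
        Finset.piecewise_eq_of_notMem _ _ _ hk]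
  simpa using h Finset.univ

theorem le_evolve {m : ℕ} (g : Fin m → ι × ι) {f : (ι → α) → ℝ} {c : ℝ} (h : ∀ x, c ≤ f x)
    (x : ι → α) : c ≤ evolve g f x := by
  induction m generalizing x with
  | zero => exact h x
  | succ m ih => exact le_nonzeroAvg (fun _ => ih _ _) _

/-- `f` does not increase when the support of the string grows. -/
def SuppAntitone (f : (ι → α) → ℝ) : Prop :=
  ∀ ⦃x y : ι → α⦄, (∀ i, y i = 0 → x i = 0) → f y ≤ f x

theorem SuppAntitone.gateAvg {f : (ι → α) → ℝ} (hf : SuppAntitone f) (i j : ι) :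
    SuppAntitone (gateAvg i j f) := by
  intro x y hxy
  refine nonzeroAvg_le_nonzeroAvg (fun p => hf fun k => ?_) (fun p => hf fun k => ?_) ?_
  · simp only [Function.update_apply]
    split_ifs
    exacts [id, id, hxy k]
  · simp only [Function.update_apply]
    split_ifs <;> simp
  · simp only [Prod.mk_eq_zero]
    exact And.imp (hxy i) (hxy j)

theorem SuppAntitone.evolve {f : (ι → α) → ℝ} (hf : SuppAntitone f) {m : ℕ}
    (g : Fin m → ι × ι) : SuppAntitone (evolve g f) := by
  induction m with
  | zero => exact hf
  | succ m ih => exact (ih _).gateAvg _ _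

theorem SuppAntitone.mul_le_gateAvg {f : (ι → α) → ℝ} (hf : SuppAntitone f) (hf₀ : ∀ x, 0 ≤ f x)
    (i j : ι) (x : ι → α) :
    (if (x i ≠ 0 ↔ x j ≠ 0) then 1 else 1 / ((Fintype.card α : ℝ) + 1)) * f x ≤
      _root_.gateAvg i j f x := by
  have hle (a b : α) (ha : x i = 0 → a = 0) (hb : x j = 0 → b = 0) :
      f x ≤ f (update (update x i a) j b) := hf fun k hk => by
    simp only [Function.update_apply]
    split_ifs with hkj hki
    exacts [hb (hkj ▸ hk), ha (hki ▸ hk), hk]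
  by_cases hi : x i = 0 <;> by_cases hj : x j = 0
  · simpa [_root_.gateAvg, hi, hj, Prod.mk_zero_zero] using hle 0 0 (fun _ => rfl) fun _ => rfl
  · rw [if_neg (by simp [hi, hj])]
    exact mul_le_nonzeroAvg_of_injective (fun _ => hf₀ _) (Prod.mk_right_injective 0) rfl
      (fun b => hle 0 b (fun _ => rfl) fun h => absurd h hj) (by simp [hj])
  · rw [if_neg (by simp [hi, hj])]
    exact mul_le_nonzeroAvg_of_injective (fun _ => hf₀ _) (Prod.mk_left_injective 0) rfl
      (fun a => hle a 0 (fun h => absurd h hi) fun _ => rfl) (by simp [hi])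
  · rw [if_pos (by simp [hi, hj]), one_mul]
    exact le_nonzeroAvg (fun p : α × α => hle p.1 p.2 (fun h => absurd h hi) fun h => absurd h hj) _

theorem SuppAntitone.mul_le_evolve {f : (ι → α) → ℝ} (hf : SuppAntitone f) (hf₀ : ∀ x, 0 ≤ f x)
    {m : ℕ} (g : Fin m → ι × ι) (x : ι → α) :
    (∏ t, if (x (g t).1 ≠ 0 ↔ x (g t).2 ≠ 0) then 1 else 1 / ((Fintype.card α : ℝ) + 1)) * f x ≤
      _root_.evolve g f x := by
  induction m generalizing x with
  | zero => simp [_root_.evolve]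
  | succ m ih =>
    rw [Fin.prod_univ_castSucc, mul_right_comm, mul_comm]
    refine le_trans (mul_le_mul_of_nonneg_left (ih (fun t => g t.castSucc) x) ?_)
      ((hf.evolve _).mul_le_gateAvg (le_evolve _ hf₀) _ _ x)
    split_ifs <;> positivity

end Strings

/-! ### Second moments of unitary conjugation -/

section UnitarilyInvariant

variable {ι : Type*} [Fintype ι] [DecidableEq ι]

theorem trace_conjStarAlgAut (W : unitaryGroup ι ℂ) (B : Matrix ι ι ℂ) :
    (conjStarAlgAut ℂ _ W B).trace = B.trace := by
  rw [conjStarAlgAut_apply, trace_mul_cycle, Unitary.coe_star_mul_self, one_mul]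

theorem trace_mul_conjStarAlgAut_inv (W : unitaryGroup ι ℂ) (B C : Matrix ι ι ℂ) :
    (B * conjStarAlgAut ℂ _ W⁻¹ C).trace = (conjStarAlgAut ℂ _ W B * C).trace := by
  rw [← trace_conjStarAlgAut W (B * _), map_mul, ← conjStarAlgAut_mul_apply, mul_inv_cancel,
    map_one, StarAlgEquiv.one_apply]

/-- Invariance of a bilinear form on matrices under simultaneous unitary conjugation. -/
def IsUnitarilyInvariant (Q : LinearMap.BilinForm ℂ (Matrix ι ι ℂ)) : Prop :=
  ∀ (W : unitaryGroup ι ℂ) (B C : Matrix ι ι ℂ),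
    Q (conjStarAlgAut ℂ _ W B) (conjStarAlgAut ℂ _ W C) = Q B C

namespace IsUnitarilyInvariant

variable {Q : LinearMap.BilinForm ℂ (Matrix ι ι ℂ)}

theorem apply_submatrix (hQ : IsUnitarilyInvariant Q) (σ : Equiv.Perm ι) (B C : Matrix ι ι ℂ) :
    Q (B.submatrix σ σ) (C.submatrix σ σ) = Q B C := by
  have hσ : σ.permMatrix ℂ ∈ unitaryGroup ι ℂ := by
    rw [mem_unitaryGroup_iff, star_eq_conjTranspose, conjTranspose_permMatrix, ← permMatrix_mul,
      inv_mul_cancel, permMatrix_one]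
  have hconj (D : Matrix ι ι ℂ) :
      σ.permMatrix ℂ * D * (σ.permMatrix ℂ)ᴴ = D.submatrix σ σ := by
    rw [conjTranspose_permMatrix, Equiv.Perm.permMatrix, Equiv.Perm.permMatrix,
      PEquiv.toMatrix_toPEquiv_mul, PEquiv.mul_toMatrix_toPEquiv, submatrix_submatrix]
    rfl
  rw [← hconj, ← hconj]
  exact hQ ⟨_, hσ⟩ B C

theorem apply_single_self (hQ : IsUnitarilyInvariant Q) (σ : Equiv.Perm ι) (a b : ι) :
    Q (single (σ a) (σ a) 1) (single (σ b) (σ b) 1) = Q (single a a 1) (single b b 1) := by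
  simpa using (hQ.apply_submatrix σ (single (σ a) (σ a) 1) (single (σ b) (σ b) 1)).symm

/-- Changing the sign of the `b`-th basis vector fixes the first argument and negates the second. -/
theorem apply_single_of_ne (hQ : IsUnitarilyInvariant Q) (a : ι) {b c : ι} (hbc : b ≠ c) :
    Q (single a a 1) (single b c 1) = 0 := by
  let s : ι → ℂ := fun i => if i = b then -1 else 1
  have hs : (diagonal s)ᴴ = diagonal s := by
    rw [diagonal_conjTranspose]
    congr 1
    ext i
    by_cases hi : i = b <;> simp [s, hi]
  have hs' : diagonal s ∈ unitaryGroup ι ℂ := by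
    rw [mem_unitaryGroup_iff, star_eq_conjTranspose, hs, diagonal_mul_diagonal, ← diagonal_one]
    congr 1
    ext i
    by_cases hi : i = b <;> simp [s, hi]
  have hconj (k l : ι) :
      diagonal s * single k l 1 * (diagonal s)ᴴ = (s k * s l) • single k l 1 := by
    rw [hs]
    ext i j
    simp only [mul_diagonal, diagonal_mul, Matrix.smul_apply, single_apply, smul_eq_mul]
    split_ifs with hij
    · rw [hij.1, hij.2, mul_right_comm]
    · simp
  have h : Q (diagonal s * single a a 1 * (diagonal s)ᴴ)
      (diagonal s * single b c 1 * (diagonal s)ᴴ) = Q (single a a 1) (single b c 1) :=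
    hQ ⟨_, hs'⟩ _ _
  have ha : s a * s a = 1 := by by_cases ha : a = b <;> simp [s, ha]
  have hb : s b * s c = -1 := by simp [s, hbc.symm]
  simp only [hconj, ha, hb, one_smul, neg_smul, map_neg] at h
  exact self_eq_neg.mp h.symm

theorem exists_apply_single (hQ : IsUnitarilyInvariant Q) :
    ∃ x y : ℂ, ∀ a b, Q (single a a 1) (single b b 1) = if a = b then x else y := by
  have hdiag : ∃ x, ∀ a, Q (single a a 1) (single a a 1) = x := by
    rcases isEmpty_or_nonempty ι with h | ⟨⟨a₀⟩⟩
    · exact ⟨0, fun a => h.elim a⟩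
    · refine ⟨Q (single a₀ a₀ 1) (single a₀ a₀ 1), fun a => ?_⟩
      simpa using hQ.apply_single_self (Equiv.swap a₀ a) a₀ a₀
  have hoff : ∃ y, ∀ a b, a ≠ b → Q (single a a 1) (single b b 1) = y := by
    by_cases h : ∃ a₀ b₀ : ι, a₀ ≠ b₀
    · obtain ⟨a₀, b₀, h₀⟩ := h
      refine ⟨Q (single a₀ a₀ 1) (single b₀ b₀ 1), fun a b hab => ?_⟩
      let c := Equiv.swap a₀ a b₀
      have hc : c ≠ a := fun h => h₀ ((Equiv.swap_apply_eq_iff.mp h).trans (by simp)).symm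
      rw [← hQ.apply_single_self (Equiv.swap c b * Equiv.swap a₀ a) a₀ b₀]
      simp [c, Equiv.swap_apply_of_ne_of_ne hc.symm hab]
    · push Not at h
      exact ⟨0, fun a b hab => absurd (h a b) hab⟩
  obtain ⟨x, hx⟩ := hdiag
  obtain ⟨y, hy⟩ := hoff
  refine ⟨x, y, fun a b => ?_⟩
  split_ifs with hab
  · exact hab ▸ hx a
  · exact hy a b hab

theorem apply_diagonal (hQ : IsUnitarilyInvariant Q) {x y : ℂ}
    (hxy : ∀ a b, Q (single a a 1) (single b b 1) = if a = b then x else y) (d : ι → ℂ)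
    (C : Matrix ι ι ℂ) :
    Q (diagonal d) C = (x - y) * (diagonal d * C).trace + y * ((diagonal d).trace * C.trace) := by
  have hsingle (a : ι) : Q (single a a 1) C = (x - y) * C a a + y * C.trace := by
    have hentry (b c : ι) : Q (single a a 1) (single b c (C b c)) =
        if b = c then C b b * (if a = b then x else y) else 0 := by
      rw [← mul_one (C b c), ← smul_eq_mul, ← smul_single, map_smul, smul_eq_mul]
      split_ifs with hbc hab
      · rw [← hbc, hxy, if_pos hab]
      · rw [← hbc, hxy, if_neg hab]
      · rw [hQ.apply_single_of_ne a hbc, mul_zero]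
    have hsplit (b : ι) : C b b * (if a = b then x else y) =
        (if a = b then (x - y) * C b b else 0) + y * C b b := by
      split_ifs <;> ring
    conv_lhs => rw [matrix_eq_sum_single C]
    simp only [map_sum, hentry, Finset.sum_ite_eq, Finset.mem_univ, if_true, hsplit,
      Finset.sum_add_distrib, ← Finset.mul_sum, trace, diag_apply]
  have hd : diagonal d = ∑ a, d a • single a a (1 : ℂ) := by
    simp only [smul_single, smul_eq_mul, mul_one, sum_single_eq_diagonal]
  conv_lhs => rw [hd]
  simp only [map_sum, map_smul, LinearMap.sum_apply, LinearMap.smul_apply, hsingle, smul_eq_mul,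
    mul_add, Finset.sum_add_distrib, trace, diag_apply, diagonal_mul, diagonal_apply_eq,
    Finset.mul_sum, Finset.sum_mul, mul_left_comm]
  exact congrArg _ Finset.sum_comm

/-- By the spectral theorem it suffices to consider a diagonal first argument. -/
theorem exists_eq_trace (hQ : IsUnitarilyInvariant Q) :
    ∃ α β : ℂ, ∀ B C, Q B C = α * (B * C).trace + β * (B.trace * C.trace) := by
  obtain ⟨x, y, hxy⟩ := hQ.exists_apply_single
  have hherm {H : Matrix ι ι ℂ} (hH : H.IsHermitian) (C : Matrix ι ι ℂ) :
      Q H C = (x - y) * (H * C).trace + y * (H.trace * C.trace) := by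
    obtain ⟨W, d, rfl⟩ : ∃ W d, H = conjStarAlgAut ℂ _ W (diagonal d) :=
      ⟨_, _, hH.spectral_theorem⟩
    obtain ⟨C, rfl⟩ : ∃ C', conjStarAlgAut ℂ _ W C' = C := (conjStarAlgAut ℂ _ W).surjective C
    rw [hQ, hQ.apply_diagonal hxy, ← map_mul, trace_conjStarAlgAut, trace_conjStarAlgAut,
      trace_conjStarAlgAut]
  refine ⟨x - y, y, fun B C => ?_⟩
  rw [← realPart_add_I_smul_imaginaryPart B]
  simp only [map_add, map_smul, LinearMap.add_apply, LinearMap.smul_apply, hherm (realPart B).2,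
    hherm (imaginaryPart B).2, add_mul, smul_mul, trace_add, trace_smul, smul_eq_mul]
  ring

end IsUnitarilyInvariant

end UnitarilyInvariant

theorem integrable_of_continuous_compactSpace {X E : Type*} [TopologicalSpace X] [CompactSpace X]
    [MeasurableSpace X] [OpensMeasurableSpace X] [NormedAddCommGroup E] {μ : Measure X}
    [IsFiniteMeasure μ] {f : X → E} (hf : Continuous f) : Integrable f μ :=
  hf.integrable_of_hasCompactSupport (HasCompactSupport.of_compactSpace f)

section ConjMoment

variable {ι : Type*} [Fintype ι] [DecidableEq ι]

theorem conjStarAlgAut_inv_apply (U : unitaryGroup ι ℂ) (A : Matrix ι ι ℂ) :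
    conjStarAlgAut ℂ _ U⁻¹ A = (U : Matrix ι ι ℂ)ᴴ * A * U := by
  rw [conjStarAlgAut_apply, ← Unitary.star_eq_inv, Unitary.coe_star, star_star,
    star_eq_conjTranspose]

theorem continuous_conjStarAlgAut_inv (A : Matrix ι ι ℂ) :
    Continuous fun U : unitaryGroup ι ℂ => conjStarAlgAut ℂ _ U⁻¹ A := by
  simp only [conjStarAlgAut_inv_apply]
  fun_prop

theorem trace_mul_eq_sum_single (A B : Matrix ι ι ℂ) :
    (A * B).trace = ∑ p : ι × ι, (single p.1 p.2 1 * A).trace * (single p.2 p.1 1 * B).trace := by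
  simp only [trace_single_mul, one_smul]
  rw [trace_mul_comm]
  simp only [Fintype.sum_prod_type, Matrix.trace, diag_apply, mul_apply, mul_comm]

variable [CompactSpace (unitaryGroup ι ℂ)] [MeasurableSpace (unitaryGroup ι ℂ)]
  [BorelSpace (unitaryGroup ι ℂ)]

theorem integrable_trace_mul_trace (μ : Measure (unitaryGroup ι ℂ)) [IsFiniteMeasure μ]
    (A A' B B' : Matrix ι ι ℂ) :
    Integrable (fun U => (B * conjStarAlgAut ℂ _ U⁻¹ A).trace *
      (B' * conjStarAlgAut ℂ _ U⁻¹ A').trace) μ := by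
  have hA := continuous_conjStarAlgAut_inv A
  have hA' := continuous_conjStarAlgAut_inv A'
  exact integrable_of_continuous_compactSpace (by fun_prop)

/-- The second moment `E tr(B U†AU) tr(B' U†A'U)` of the conjugation of `A` and `A'` by a random
unitary `U`, as a bilinear form in `B` and `B'`. -/
noncomputable def conjMoment (μ : Measure (unitaryGroup ι ℂ)) [IsFiniteMeasure μ]
    (A A' : Matrix ι ι ℂ) : LinearMap.BilinForm ℂ (Matrix ι ι ℂ) :=
  LinearMap.mk₂ ℂ
    (fun B B' => ∫ U, (B * conjStarAlgAut ℂ _ U⁻¹ A).trace *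
      (B' * conjStarAlgAut ℂ _ U⁻¹ A').trace ∂μ)
    (fun B C B' => by
      simp only [add_mul, trace_add]
      exact integral_add (integrable_trace_mul_trace ..) (integrable_trace_mul_trace ..))
    (fun c B B' => by
      simp only [smul_mul, trace_smul, smul_eq_mul, mul_assoc, integral_const_mul])
    (fun B B' C' => by
      simp only [add_mul, trace_add, mul_add]
      exact integral_add (integrable_trace_mul_trace ..) (integrable_trace_mul_trace ..))
    (fun c B B' => by
      simp only [smul_mul, trace_smul, smul_eq_mul, mul_left_comm _ c, integral_const_mul])

theorem conjMoment_apply (μ : Measure (unitaryGroup ι ℂ)) [IsFiniteMeasure μ]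
    (A A' B B' : Matrix ι ι ℂ) :
    conjMoment μ A A' B B' = ∫ U, (B * conjStarAlgAut ℂ _ U⁻¹ A).trace *
      (B' * conjStarAlgAut ℂ _ U⁻¹ A').trace ∂μ := rfl

theorem isUnitarilyInvariant_conjMoment (μ : Measure (unitaryGroup ι ℂ)) [IsFiniteMeasure μ]
    [μ.IsMulRightInvariant] (A A' : Matrix ι ι ℂ) : IsUnitarilyInvariant (conjMoment μ A A') := by
  intro W B B'
  rw [conjMoment_apply μ A A' B B', ← integral_mul_right_eq_self _ W, conjMoment_apply]
  simp only [← trace_mul_conjStarAlgAut_inv, ← conjStarAlgAut_mul_apply, _root_.mul_inv_rev]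

theorem conjMoment_apply_of_trace_eq_zero [Nontrivial ι] (μ : Measure (unitaryGroup ι ℂ))
    [IsProbabilityMeasure μ] [μ.IsMulRightInvariant] {A : Matrix ι ι ℂ} (hA : A.trace = 0)
    (A' B B' : Matrix ι ι ℂ) :
    conjMoment μ A A' B B' = (A * A').trace / ((Fintype.card ι : ℂ) ^ 2 - 1) *
      ((B * B').trace - B.trace * B'.trace / Fintype.card ι) := by
  obtain ⟨α, β, h⟩ := (isUnitarilyInvariant_conjMoment μ A A').exists_eq_trace
  obtain ⟨N, hN⟩ : ∃ N : ℂ, N = Fintype.card ι := ⟨_, rfl⟩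
  have hN₀ : N ≠ 0 := by simp [hN]
  have hN₁ : N ^ 2 - 1 ≠ 0 := by
    have : (Fintype.card ι) ^ 2 ≠ 1 := by simp [Fintype.one_lt_card.ne']
    rw [sub_ne_zero, hN]
    exact_mod_cast this
  have hα : α = -β * N := by
    have h₁ : conjMoment μ A A' 1 1 = 0 := by
      simp [conjMoment_apply, hA]
    have h₂ : α * N + β * (N * N) = 0 := by simpa [← hN] using (h 1 1).symm.trans h₁
    apply mul_right_cancel₀ hN₀
    linear_combination h₂
  have hβ : α * N ^ 2 + β * N = (A * A').trace := by
    have h₁ : ∑ p : ι × ι, conjMoment μ A A' (single p.1 p.2 1) (single p.2 p.1 1) =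
        (A * A').trace := by
      simp only [conjMoment_apply]
      rw [← integral_finsetSum _ fun p _ => integrable_trace_mul_trace ..]
      simp only [← trace_mul_eq_sum_single, ← map_mul, trace_conjStarAlgAut, integral_const,
        probReal_univ, one_smul]
    have h₂ : ∑ p : ι × ι, (single p.1 p.2 (1 : ℂ)).trace * (single p.2 p.1 (1 : ℂ)).trace = N := by
      simpa [hN] using (trace_mul_eq_sum_single (1 : Matrix ι ι ℂ) 1).symm
    rw [← h₁]
    simp only [h, single_mul_single_same, trace_single_eq_same, mul_one, Finset.sum_add_distrib,
      ← Finset.mul_sum, h₂, Finset.sum_const, Finset.card_univ, Fintype.card_prod, nsmul_eq_mul,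
      Nat.cast_mul, ← hN]
    ring
  rw [h, ← hN, ← hβ, hα]
  field_simp
  ring

theorem conjMoment_apply_single (μ : Measure (unitaryGroup ι ℂ)) [IsFiniteMeasure μ]
    (A A' : Matrix ι ι ℂ) (a b a' b' : ι) :
    conjMoment μ A A' (single a b 1) (single a' b' 1) =
      ∑ p : ι × ι, ∑ p' : ι × ι, A p.1 p.2 * A' p'.1 p'.2 *
        ∫ U : unitaryGroup ι ℂ, (U : Matrix ι ι ℂ) p.2 a * (U : Matrix ι ι ℂ) p'.2 a' *
          star ((U : Matrix ι ι ℂ) p.1 b) * star ((U : Matrix ι ι ℂ) p'.1 b') ∂μ := by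
  have hentry (D : Matrix ι ι ℂ) (c d : ι) (U : unitaryGroup ι ℂ) :
      (single c d 1 * conjStarAlgAut ℂ _ U⁻¹ D).trace =
        ∑ p : ι × ι, D p.1 p.2 * ((U : Matrix ι ι ℂ) p.2 c * star ((U : Matrix ι ι ℂ) p.1 d)) := by
    rw [trace_single_mul, one_smul, conjStarAlgAut_inv_apply, Fintype.sum_prod_type_right]
    simp only [mul_apply, conjTranspose_apply, Finset.sum_mul]
    exact Finset.sum_congr rfl fun k _ => Finset.sum_congr rfl fun l _ => by ring
  have hcont (D : Matrix ι ι ℂ) (c d : ι) (p : ι × ι) : Continuous fun U : unitaryGroup ι ℂ =>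
      D p.1 p.2 * ((U : Matrix ι ι ℂ) p.2 c * star ((U : Matrix ι ι ℂ) p.1 d)) :=
    have hU (k l : ι) : Continuous fun U : unitaryGroup ι ℂ => (U : Matrix ι ι ℂ) k l :=
      continuous_subtype_val.matrix_elem k l
    continuous_const.mul ((hU _ _).mul (hU _ _).star)
  have hint (p p' : ι × ι) := integrable_of_continuous_compactSpace (μ := μ)
    ((hcont A a b p).fun_mul (hcont A' a' b' p'))
  simp only [conjMoment_apply, hentry, Finset.sum_mul_sum, ← integral_const_mul]
  rw [integral_finsetSum _ fun p _ => integrable_finsetSum _ fun p' _ => hint p p']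
  refine Finset.sum_congr rfl fun p _ => ?_
  rw [integral_finsetSum _ fun p' _ => hint p p']
  exact Finset.sum_congr rfl fun p' _ => integral_congr_ae (.of_forall fun U => by ring)

end ConjMoment

section TwoDesign

variable {q : ℕ}

instance instSecondCountableTopologyMatrix {m n : Type*} [Countable m] [Countable n] :
    SecondCountableTopology (Matrix m n ℂ) :=
  inferInstanceAs (SecondCountableTopology (m → n → ℂ))

instance instSecondCountableTopologyU2 (q : ℕ) : SecondCountableTopology (U2 q) :=
  TopologicalSpace.Subtype.secondCountableTopology _

instance instIsProbabilityMeasureHaarU2 (q : ℕ) : IsProbabilityMeasure (haarU2 q) :=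
  ⟨Measure.haarMeasure_self⟩

instance instIsHaarMeasureHaarU2 (q : ℕ) : (haarU2 q).IsHaarMeasure := by
  unfold haarU2
  infer_instance

instance instIsMulRightInvariantHaarU2 (q : ℕ) : (haarU2 q).IsMulRightInvariant where
  map_mul_right_eq_self g := by
    have : IsProbabilityMeasure ((haarU2 q).map (· * g)) :=
      Measure.isProbabilityMeasure_map (by fun_prop)
    exact Measure.isHaarMeasure_eq_of_isProbabilityMeasure _ _

theorem IsTwoDesign.integral_trace_mul_trace {μ : Measure (U2 q)} (hμ : IsTwoDesign μ)
    (A A' B B' : TwoSite q) :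
    ∫ U, (B * conjStarAlgAut ℂ _ U⁻¹ A).trace * (B' * conjStarAlgAut ℂ _ U⁻¹ A').trace ∂μ =
      ∫ U, (B * conjStarAlgAut ℂ _ U⁻¹ A).trace * (B' * conjStarAlgAut ℂ _ U⁻¹ A').trace
        ∂haarU2 q := by
  have := hμ.1
  suffices h : conjMoment μ A A' = conjMoment (haarU2 q) A A' from LinearMap.congr_fun₂ h B B'
  refine LinearMap.BilinForm.ext_basis (stdBasis ℂ _ _) fun ⟨a, b⟩ ⟨a', b'⟩ => ?_
  simp only [stdBasis_eq_single, conjMoment_apply_single, hμ.2]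

end TwoDesign

/-! ### Operator bases -/

section OperatorBasis

variable {ι κ : Type*} [Fintype ι] [DecidableEq ι] [Fintype κ] [DecidableEq κ] [Zero κ]

/-- An orthogonal basis of a matrix algebra, for the trace inner product, whose element of index `0`
is the identity and all of whose elements have the norm of the identity. -/
structure IsUnitalOrthogonalBasis (E : κ → Matrix ι ι ℂ) : Prop where
  map_zero : E 0 = 1
  trace_mul : ∀ k l, ((E k)ᴴ * E l).trace = if k = l then (Fintype.card ι : ℂ) else 0
  card_eq : Fintype.card κ = Fintype.card ι ^ 2

theorem IsOperatorBasis.isUnitalOrthogonalBasis {q : ℕ} [NeZero q]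
    {M : Fin (q ^ 2) → Matrix (Fin q) (Fin q) ℂ} (hM : IsOperatorBasis M) :
    IsUnitalOrthogonalBasis M where
  map_zero := hM.zero
  trace_mul := by simpa using hM.trace
  card_eq := by simp

namespace IsUnitalOrthogonalBasis

variable {E : κ → Matrix ι ι ℂ}

theorem kronecker {ι' κ' : Type*} [Fintype ι'] [DecidableEq ι'] [Fintype κ'] [DecidableEq κ']
    [Zero κ'] {F : κ' → Matrix ι' ι' ℂ} (hE : IsUnitalOrthogonalBasis E)
    (hF : IsUnitalOrthogonalBasis F) :
    IsUnitalOrthogonalBasis fun k : κ × κ' => E k.1 ⊗ₖ F k.2 where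
  map_zero := by simp [hE.map_zero, hF.map_zero]
  trace_mul k l := by
    rw [conjTranspose_kronecker, ← mul_kronecker_mul, trace_kronecker, hE.trace_mul, hF.trace_mul,
      Fintype.card_prod, Nat.cast_mul, ite_zero_mul_ite_zero]
    simp only [Prod.ext_iff]
  card_eq := by rw [Fintype.card_prod, Fintype.card_prod, hE.card_eq, hF.card_eq, mul_pow]

theorem card_ne_zero (hE : IsUnitalOrthogonalBasis E) : (Fintype.card ι : ℂ) ≠ 0 := by
  have : Fintype.card κ ≠ 0 := Fintype.card_ne_zero
  simpa [hE.card_eq] using this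

theorem trace_eq_zero (hE : IsUnitalOrthogonalBasis E) {k : κ} (hk : k ≠ 0) : (E k).trace = 0 := by
  simpa [hE.map_zero, hk.symm] using hE.trace_mul 0 k

theorem sum_norm_sq_trace_mul (hE : IsUnitalOrthogonalBasis E) (B : Matrix ι ι ℂ) :
    ∑ k, (‖(B * E k).trace‖ : ℂ) ^ 2 = Fintype.card ι * (B * Bᴴ).trace := by
  let T : Matrix κ (ι × ι) ℂ := of fun k p => E k p.1 p.2
  let b : ι × ι → ℂ := fun p => B p.2 p.1
  have hrows : T * Tᴴ = (Fintype.card ι : ℂ) • 1 := by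
    ext k l
    rw [mul_apply, Fintype.sum_prod_type_right, Matrix.smul_apply, one_apply, smul_eq_mul,
      mul_ite, mul_one, mul_zero]
    simpa only [Matrix.trace, diag_apply, mul_apply, conjTranspose_apply, mul_comm,
      eq_comm (a := l), T, of_apply] using hE.trace_mul l k
  have hcols : Tᴴ * T = (Fintype.card ι : ℂ) • 1 := by
    have h : ((Fintype.card ι : ℂ)⁻¹ • T) * Tᴴ = 1 := by
      rw [smul_mul, hrows, inv_smul_smul₀ hE.card_ne_zero]
    rw [mul_eq_one_comm_of_card_eq _ _ _ (by rw [hE.card_eq, Fintype.card_prod, sq]),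
      Matrix.mul_smul] at h
    rw [← h, smul_inv_smul₀ hE.card_ne_zero]
  have hTb (k : κ) : (B * E k).trace = (T *ᵥ b) k := by
    rw [trace_mul_comm]
    simp only [Matrix.trace, diag_apply, mul_apply, mulVec, dotProduct, Fintype.sum_prod_type, T, b,
      of_apply]
  calc ∑ k, (‖(B * E k).trace‖ : ℂ) ^ 2
      = star (T *ᵥ b) ⬝ᵥ (T *ᵥ b) := by simp [dotProduct, hTb, Complex.conj_mul']
    _ = star b ⬝ᵥ ((Tᴴ * T) *ᵥ b) := by
      rw [star_mulVec, ← dotProduct_mulVec, mulVec_mulVec]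
    _ = Fintype.card ι * (star b ⬝ᵥ b) := by
      rw [hcols, smul_mulVec, one_mulVec, dotProduct_smul, smul_eq_mul]
    _ = Fintype.card ι * (B * Bᴴ).trace := by
      rw [trace_mul_comm]
      simp only [Matrix.trace, diag_apply, mul_apply, conjTranspose_apply, dotProduct,
        Fintype.sum_prod_type, b, Pi.star_apply]

theorem nonzeroAvg_norm_sq_trace_mul (hE : IsUnitalOrthogonalBasis E) (B : Matrix ι ι ℂ) {k : κ}
    (hk : k ≠ 0) :
    ((nonzeroAvg (fun c => ‖(B * E c).trace‖ ^ 2) k : ℝ) : ℂ) =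
      Fintype.card ι / ((Fintype.card ι : ℂ) ^ 2 - 1) *
        ((B * Bᴴ).trace - ‖B.trace‖ ^ 2 / Fintype.card ι) := by
  have hcard : ((Finset.univ.filter fun c : κ => c ≠ 0).card : ℂ) = Fintype.card ι ^ 2 - 1 := by
    rw [Finset.filter_ne', Finset.card_erase_of_mem (Finset.mem_univ _), Finset.card_univ,
      Nat.cast_sub Fintype.card_pos, hE.card_eq, Nat.cast_pow, Nat.cast_one]
  have hsum := sum_eq_zero_add_sum_ne_zero fun c => ‖(B * E c).trace‖ ^ 2
  apply_fun ((↑) : ℝ → ℂ) at hsum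
  push_cast at hsum
  rw [hE.sum_norm_sq_trace_mul, hE.map_zero, mul_one] at hsum
  rw [nonzeroAvg_of_ne_zero _ hk, Finset.expect_eq_sum_div_card]
  push_cast
  rw [hcard, div_mul_eq_mul_div, mul_sub, hsum, mul_div_cancel₀ _ hE.card_ne_zero,
    add_sub_cancel_left]

end IsUnitalOrthogonalBasis

end OperatorBasis

section TwoDesign

variable {q : ℕ} {μ : Measure (U2 q)}

theorem IsTwoDesign.integral_norm_sq_trace_of_trace_eq_zero (hq : 2 ≤ q) (hμ : IsTwoDesign μ)
    {A : TwoSite q} (hA : A.trace = 0) (B : TwoSite q) :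
    ((∫ V, ‖(B * conjStarAlgAut ℂ _ V⁻¹ A).trace‖ ^ 2 ∂μ : ℝ) : ℂ) =
      (A * Aᴴ).trace / ((q ^ 2 : ℂ) ^ 2 - 1) * ((B * Bᴴ).trace - ‖B.trace‖ ^ 2 / q ^ 2) := by
  have hι : Nontrivial (Fin q × Fin q) := by
    have : Nontrivial (Fin q) := Fin.nontrivial_iff_two_le.mpr hq
    infer_instance
  have hnorm (V : U2 q) : ((‖(B * conjStarAlgAut ℂ _ V⁻¹ A).trace‖ ^ 2 : ℝ) : ℂ) =
      (B * conjStarAlgAut ℂ _ V⁻¹ A).trace * (Bᴴ * conjStarAlgAut ℂ _ V⁻¹ Aᴴ).trace := by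
    rw [← star_eq_conjTranspose A, map_star, star_eq_conjTranspose, trace_mul_comm Bᴴ,
      ← conjTranspose_mul, trace_conjTranspose, Complex.star_def, Complex.mul_conj',
      Complex.ofReal_pow]
  have hcard : (Fintype.card (Fin q × Fin q) : ℂ) = q ^ 2 := by simp [sq]
  simp only [← integral_complex_ofReal, hnorm]
  rw [hμ.integral_trace_mul_trace, ← conjMoment_apply, conjMoment_apply_of_trace_eq_zero _ hA,
    hcard, trace_conjTranspose, Complex.star_def, Complex.mul_conj']

theorem IsTwoDesign.integral_norm_sq_trace (hq : 2 ≤ q) (hμ : IsTwoDesign μ) {κ : Type*} [Fintype κ]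
    [DecidableEq κ] [Zero κ] {E : κ → TwoSite q} (hE : IsUnitalOrthogonalBasis E) (W W' : U2 q)
    (B : TwoSite q) (k : κ) :
    ∫ V, ‖(B * conjStarAlgAut ℂ _ (W * V * W')⁻¹ (E k)).trace‖ ^ 2 ∂μ =
      nonzeroAvg (fun c => ‖(B * E c).trace‖ ^ 2) k := by
  have := hμ.1
  by_cases hk : k = 0
  · simp [hk, hE.map_zero]
  have hV (V : U2 q) : (B * conjStarAlgAut ℂ _ (W * V * W')⁻¹ (E k)).trace =
      (conjStarAlgAut ℂ _ W' B * conjStarAlgAut ℂ _ V⁻¹ (conjStarAlgAut ℂ _ W⁻¹ (E k))).trace := by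
    rw [_root_.mul_inv_rev, _root_.mul_inv_rev, conjStarAlgAut_mul_apply, conjStarAlgAut_mul_apply,
      trace_mul_conjStarAlgAut_inv]
  have htrace : (conjStarAlgAut ℂ _ W⁻¹ (E k)).trace = 0 := by
    rw [trace_conjStarAlgAut, hE.trace_eq_zero hk]
  have hnorm : (E k * (E k)ᴴ).trace = (q : ℂ) ^ 2 := by
    rw [trace_mul_comm, hE.trace_mul, if_pos rfl]
    simp [sq]
  apply Complex.ofReal_injective
  simp only [hV]
  rw [hμ.integral_norm_sq_trace_of_trace_eq_zero hq htrace, hE.nonzeroAvg_norm_sq_trace_mul B hk]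
  simp only [← star_eq_conjTranspose, ← map_star, ← map_mul, trace_conjStarAlgAut]
  rw [star_eq_conjTranspose, hnorm]
  simp [sq]

end TwoDesign

/-! ### Gates acting on two sites -/

section Sites

variable {n : ℕ}

/-- The sites other than `i` and `j`. -/
abbrev OtherSites (i j : Fin n) : Type := {k : Fin n // k ≠ i ∧ k ≠ j}

/-- The splitting of a configuration into its values at `i` and `j` and on the other sites. -/
def siteEquiv {i j : Fin n} (hij : i ≠ j) (α : Type*) :
    (Fin n → α) ≃ (α × α) × (OtherSites i j → α) where
  toFun s := ((s i, s j), fun k => s k)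
  invFun p k := if hi : k = i then p.1.1 else if hj : k = j then p.1.2 else p.2 ⟨k, hi, hj⟩
  left_inv s := by
    ext k
    dsimp only
    split_ifs with hi hj
    · rw [hi]
    · rw [hj]
    · rfl
  right_inv p := by
    refine Prod.ext (Prod.ext (by simp) (by simp [hij.symm])) (funext fun k => ?_)
    simp [k.2.1, k.2.2]

variable {q : ℕ} {i j : Fin n}

/-- The operator on all sites whose matrix, after splitting off the sites `i` and `j`, is the tensor
product of `B` on these two sites and `R` on the others. -/
def embedSites (hij : i ≠ j) (B : TwoSite q)
    (R : Matrix (OtherSites i j → Fin q) (OtherSites i j → Fin q) ℂ) : QuditOp n q :=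
  (kronecker B R).submatrix (siteEquiv hij _) (siteEquiv hij _)

theorem onSites_eq_embedSites (hij : i ≠ j) (G : TwoSite q) :
    onSites i j G = embedSites hij G 1 := by
  ext s t
  simp [onSites, embedSites, siteEquiv, one_apply, funext_iff]

/-- The tensor factor of `M_x` on the sites other than `i` and `j`. -/
def otherSitesOp (i j : Fin n) (M : Fin (q ^ 2) → Matrix (Fin q) (Fin q) ℂ)
    (x : Fin n → Fin (q ^ 2)) : Matrix (OtherSites i j → Fin q) (OtherSites i j → Fin q) ℂ :=
  of fun s t => ∏ k : OtherSites i j, M (x k) (s k) (t k)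

theorem tensorOp_eq_embedSites (hij : i ≠ j) (M : Fin (q ^ 2) → Matrix (Fin q) (Fin q) ℂ)
    (x : Fin n → Fin (q ^ 2)) :
    tensorOp M x = embedSites hij (kronecker (M (x i)) (M (x j))) (otherSitesOp i j M x) := by
  ext s t
  rw [tensorOp, of_apply, ← Finset.prod_mul_prod_compl {i, j}, Finset.prod_pair hij,
    Finset.prod_subtype (p := fun k => k ≠ i ∧ k ≠ j) _ (by simp)]
  rfl

theorem tensorOp_update_update (hij : i ≠ j) (M : Fin (q ^ 2) → Matrix (Fin q) (Fin q) ℂ)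
    (x : Fin n → Fin (q ^ 2)) (p : Fin (q ^ 2) × Fin (q ^ 2)) :
    tensorOp M (update (update x i p.1) j p.2) =
      embedSites hij (kronecker (M p.1) (M p.2)) (otherSitesOp i j M x) := by
  have hrest : otherSitesOp i j M (update (update x i p.1) j p.2) = otherSitesOp i j M x := by
    ext s t
    rw [otherSitesOp, otherSitesOp, of_apply, of_apply]
    exact Finset.prod_congr rfl fun k _ => by
      rw [Function.update_of_ne k.2.2, Function.update_of_ne k.2.1]
  rw [tensorOp_eq_embedSites hij, hrest, Function.update_of_ne hij, Function.update_self,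
    Function.update_self]

theorem conjTranspose_onSites_mul_embedSites_mul_onSites (hij : i ≠ j) (G B : TwoSite q)
    (R : Matrix (OtherSites i j → Fin q) (OtherSites i j → Fin q) ℂ) :
    (onSites i j G)ᴴ * embedSites hij B R * onSites i j G = embedSites hij (Gᴴ * B * G) R := by
  simp only [onSites_eq_embedSites hij, embedSites, kronecker]
  rw [conjTranspose_submatrix, conjTranspose_kronecker,
    conjTranspose_one, submatrix_mul_equiv, submatrix_mul_equiv, ← mul_kronecker_mul,
    ← mul_kronecker_mul, one_mul, mul_one]

theorem exists_eq_trace_mul {ι : Type*} [Fintype ι] (L : Matrix ι ι ℂ →ₗ[ℂ] ℂ) :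
    ∃ C : Matrix ι ι ℂ, ∀ B, L B = (C * B).trace := by
  classical
  refine ⟨of fun j i => L (single i j 1), fun B => ?_⟩
  refine LinearMap.congr_fun (f := L) (g := traceLinearMap ι ℂ ℂ ∘ₗ LinearMap.mulLeft ℂ _) ?_ B
  refine ext_linearMap _ fun i j => LinearMap.ext_ring ?_
  simp [trace_mul_single]

theorem exists_conj_embedSites_apply_eq_trace (hij : i ≠ j) (D : QuditOp n q)
    (R : Matrix (OtherSites i j → Fin q) (OtherSites i j → Fin q) ℂ) (s t : Fin n → Fin q) :
    ∃ C : TwoSite q, ∀ B, (Dᴴ * embedSites hij B R * D) s t = (C * B).trace :=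
  exists_eq_trace_mul
    { toFun := fun B => (Dᴴ * embedSites hij B R * D) s t
      map_add' := fun B B' => by
        simp only [embedSites, kronecker, add_kronecker, submatrix_add, Pi.add_apply, mul_add,
          add_mul, Matrix.add_apply]
      map_smul' := fun c B => by
        simp only [embedSites, kronecker, smul_kronecker, submatrix_smul, Pi.smul_apply,
          Matrix.mul_smul, Matrix.smul_mul, Matrix.smul_apply, RingHom.id_apply] }

theorem IsTwoDesign.integral_onSites [NeZero q] (hq : 2 ≤ q)
    {M : Fin (q ^ 2) → Matrix (Fin q) (Fin q) ℂ} (hM : IsOperatorBasis M) {μ : Measure (U2 q)}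
    (hμ : IsTwoDesign μ) (W W' : U2 q) (hij : i ≠ j) (D : QuditOp n q) (x : Fin n → Fin (q ^ 2)) :
    ∫ V : U2 q, ‖((onSites i j (W * V * W' : TwoSite q) * D)ᴴ * tensorOp M x *
        (onSites i j (W * V * W' : TwoSite q) * D)) 0 0‖ ^ 2 ∂μ =
      gateAvg i j (fun y => ‖(Dᴴ * tensorOp M y * D) 0 0‖ ^ 2) x := by
  obtain ⟨C, hC⟩ := exists_conj_embedSites_apply_eq_trace hij D (otherSitesOp i j M x) 0 0
  have hE := hM.isUnitalOrthogonalBasis.kronecker hM.isUnitalOrthogonalBasis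
  have hgate (V : U2 q) : ((onSites i j (W * V * W' : TwoSite q) * D)ᴴ * tensorOp M x *
      (onSites i j (W * V * W' : TwoSite q) * D)) 0 0 =
        (C * conjStarAlgAut ℂ _ (W * V * W')⁻¹ (kronecker (M (x i)) (M (x j)))).trace := by
    rw [← hC, conjStarAlgAut_inv_apply, Submonoid.coe_mul, Submonoid.coe_mul,
      ← conjTranspose_onSites_mul_embedSites_mul_onSites hij, ← tensorOp_eq_embedSites hij,
      conjTranspose_mul]
    simp only [Matrix.mul_assoc]
  simp only [hgate, gateAvg, tensorOp_update_update hij, hC]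
  exact hμ.integral_norm_sq_trace hq hE W W' C (x i, x j)

end Sites

/-! ### The average over the circuit -/

theorem integral_pi_succ {X E : Type*} [MeasurableSpace X] [NormedAddCommGroup E] [NormedSpace ℝ E]
    {m : ℕ} (μ : Fin (m + 1) → Measure X) [∀ t, SigmaFinite (μ t)] {f : (Fin (m + 1) → X) → E}
    (hf : Integrable f (Measure.pi μ)) :
    ∫ V, f V ∂Measure.pi μ = ∫ V : Fin m → X, ∫ v, f (Fin.snoc V v) ∂μ (Fin.last m)
      ∂Measure.pi fun t => μ t.castSucc := by
  have h := (measurePreserving_piFinSuccAbove μ (Fin.last m)).symm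
  rw [← h.integral_comp']
  refine (integral_prod_symm _ (h.integrable_comp_of_integrable hf)).trans ?_
  simp only [Function.comp_apply, Fin.succAbove_last, MeasurableEquiv.piFinSuccAbove_symm_apply,
    Fin.insertNthEquiv_last]
  rfl

section Circuit

variable {n q m : ℕ} {X : Type*} [TopologicalSpace X]

/-- The circuit whose `t`-th gate, in order of application, is `W t * V t * W' t` on the pair of
sites `g t`. -/
def circuitOp (g : Fin m → Fin n × Fin n) (W W' V : Fin m → U2 q) : QuditOp n q :=
  (List.ofFn fun t => onSites (g t).1 (g t).2 (W t * V t * W' t : TwoSite q)).reverse.prod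

theorem circuitOp_succ (g : Fin (m + 1) → Fin n × Fin n) (W W' V : Fin (m + 1) → U2 q) :
    circuitOp g W W' V =
      onSites (g (Fin.last m)).1 (g (Fin.last m)).2
          (W (Fin.last m) * V (Fin.last m) * W' (Fin.last m) : TwoSite q) *
        circuitOp (fun t : Fin m => g t.castSucc) (fun t => W t.castSucc) (fun t => W' t.castSucc)
          fun t => V t.castSucc := by
  rw [circuitOp, List.ofFn_succ', List.concat_eq_append, List.reverse_append,
    List.reverse_singleton, List.singleton_append, List.prod_cons, circuitOp]

theorem continuous_onSites (i j : Fin n) : Continuous (onSites i j : TwoSite q → QuditOp n q) := by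
  refine continuous_matrix fun s t => ?_
  simp only [onSites, of_apply]
  split_ifs
  · exact continuous_id.matrix_elem _ _
  · exact continuous_const

theorem continuous_circuitOp (g : Fin m → Fin n × Fin n) {W W' V : X → Fin m → U2 q}
    (hW : Continuous W) (hW' : Continuous W') (hV : Continuous V) :
    Continuous fun z => circuitOp g (W z) (W' z) (V z) := by
  induction m with
  | zero => exact continuous_const
  | succ m ih =>
    simp only [circuitOp_succ]
    refine ((continuous_onSites _ _).comp ?_).mul (ih _ ?_ ?_ ?_)
    all_goals fun_prop

theorem continuous_norm_sq_expectation [NeZero q] {D : X → QuditOp n q} (hD : Continuous D)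
    (T : QuditOp n q) : Continuous fun z => ‖((D z)ᴴ * T * D z) 0 0‖ ^ 2 :=
  ((hD.matrix_conjTranspose.mul continuous_const).mul hD).matrix_elem 0 0 |>.norm.pow 2

theorem integral_circuitOp [NeZero q] (hq : 2 ≤ q) {M : Fin (q ^ 2) → Matrix (Fin q) (Fin q) ℂ}
    (hM : IsOperatorBasis M) {g : Fin m → Fin n × Fin n} (hne : ∀ t, (g t).1 ≠ (g t).2)
    (W W' : Fin m → U2 q) {law : Fin m → Measure (U2 q)} (hlaw : ∀ t, IsTwoDesign (law t))
    (x : Fin n → Fin (q ^ 2)) :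
    ∫ V, ‖((circuitOp g W W' V)ᴴ * tensorOp M x * circuitOp g W W' V) 0 0‖ ^ 2 ∂Measure.pi law =
      evolve g (fun y => ∏ i, ‖M (y i) 0 0‖ ^ 2) x := by
  have hprob (t : Fin m) : IsProbabilityMeasure (law t) := (hlaw t).1
  have hint {k : ℕ} (g : Fin k → Fin n × Fin n) (W W' : Fin k → U2 q)
      (ν : Measure (Fin k → U2 q)) [IsFiniteMeasure ν] (y : Fin n → Fin (q ^ 2)) :
      Integrable (fun V =>
        ‖((circuitOp g W W' V)ᴴ * tensorOp M y * circuitOp g W W' V) 0 0‖ ^ 2) ν :=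
    integrable_of_continuous_compactSpace (continuous_norm_sq_expectation
      (continuous_circuitOp g continuous_const continuous_const continuous_id) _)
  induction m generalizing x with
  | zero => simp [circuitOp, evolve, tensorOp, norm_prod, Finset.prod_pow]
  | succ m ih =>
    rw [integral_pi_succ _ (hint ..)]
    simp only [circuitOp_succ, Fin.snoc_last, Fin.snoc_castSucc,
      (hlaw _).integral_onSites hq hM _ _ (hne _)]
    simp only [evolve, gateAvg]
    rw [integral_nonzeroAvg fun p => hint ..]
    simp only [ih (fun _ => hne _) _ _ (fun _ => hlaw _) _ fun _ => hprob _]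

end Circuit

section Parameters

variable {q p : ℕ}

theorem ParamGate.mat_mem_unitaryGroup (g : ParamGate q p) (θ : Fin p → ℝ) :
    g.mat θ ∈ unitaryGroup (Fin q × Fin q) ℂ := by
  have hstar : star (-(Complex.I * (θ g.param : ℂ)) • g.A) =
      -(-(Complex.I * (θ g.param : ℂ)) • g.A) := by
    rw [star_smul, star_eq_conjTranspose, g.hermitian.eq, ← neg_smul]
    simp
  refine mul_mem (mul_mem g.Wl.2 ?_) g.Wr.2
  rw [mem_unitaryGroup_iff, star_eq_conjTranspose, ← exp_conjTranspose, ← star_eq_conjTranspose,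
    hstar, ← exp_add_of_commute _ _ (Commute.refl (_ : TwoSite q)).neg_right, add_neg_cancel,
    NormedSpace.exp_zero]

theorem paramSeq_mem_unitaryGroup (l : List (ParamGate q p)) (θ : Fin p → ℝ) :
    paramSeq l θ ∈ unitaryGroup (Fin q × Fin q) ℂ := by
  refine Submonoid.list_prod_mem _ fun A hA => ?_
  simp only [List.mem_reverse, List.mem_map] at hA
  obtain ⟨g, -, rfl⟩ := hA
  exact g.mat_mem_unitaryGroup θ

theorem continuous_matrix_exp {ι : Type*} [Fintype ι] [DecidableEq ι] :
    Continuous (NormedSpace.exp : Matrix ι ι ℂ → Matrix ι ι ℂ) := by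
  let : NormedRing (Matrix ι ι ℂ) := Matrix.linftyOpNormedRing
  let : NormedAlgebra ℂ (Matrix ι ι ℂ) := Matrix.linftyOpNormedAlgebra
  let : NormedAlgebra ℚ (Matrix ι ι ℂ) := NormedAlgebra.restrictScalars ℚ ℂ _
  exact NormedSpace.exp_continuous

theorem ParamGate.continuous_mat (g : ParamGate q p) : Continuous g.mat := by
  unfold ParamGate.mat
  refine (continuous_const.mul (continuous_matrix_exp.comp ?_)).mul continuous_const
  fun_prop

theorem continuous_paramSeq (l : List (ParamGate q p)) : Continuous (paramSeq l) := by
  unfold paramSeq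
  simp only [← List.map_reverse]
  exact continuous_list_prod _ fun g _ => g.continuous_mat

/-- The unitary performed by a list of parameterized gates, as an element of `U(q²)`. -/
noncomputable def paramUnitary (l : List (ParamGate q p)) (θ : Fin p → ℝ) : U2 q :=
  ⟨paramSeq l θ, paramSeq_mem_unitaryGroup l θ⟩

theorem continuous_paramUnitary (l : List (ParamGate q p)) : Continuous (paramUnitary l) :=
  (continuous_paramSeq l).subtype_mk _

theorem volume_Icc_two_pi_ne_zero (p : ℕ) :
    volume (Set.Icc (0 : Fin p → ℝ) fun _ => 2 * Real.pi) ≠ 0 := by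
  rw [Real.volume_Icc_pi, Finset.prod_ne_zero_iff]
  simp [Real.pi_pos]

instance instIsProbabilityMeasureUniformParams (p : ℕ) :
    IsProbabilityMeasure (uniformParams p) :=
  cond_isProbabilityMeasure_of_finite (volume_Icc_two_pi_ne_zero p)
    isCompact_Icc.measure_lt_top.ne

theorem integrable_prod_uniformParams {X : Type*} [TopologicalSpace X] [CompactSpace X] [T2Space X]
    [SecondCountableTopology X] [MeasurableSpace X] [BorelSpace X] {μ : Measure X}
    [IsFiniteMeasure μ] {f : X × (Fin p → ℝ) → ℝ} (hf : Continuous f) :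
    Integrable f (μ.prod (uniformParams p)) := by
  have h : μ.prod (uniformParams p) =
      (volume (Set.Icc (0 : Fin p → ℝ) fun _ => 2 * Real.pi))⁻¹ •
        (μ.prod volume).restrict (Set.univ ×ˢ Set.Icc (0 : Fin p → ℝ) fun _ => 2 * Real.pi) := by
    rw [uniformParams, ProbabilityTheory.cond, Measure.prod_smul_right, ← Measure.prod_restrict,
      Measure.restrict_univ]
  rw [h]
  refine Integrable.smul_measure ?_ (ENNReal.inv_ne_top.mpr (volume_Icc_two_pi_ne_zero p))
  exact hf.continuousOn.integrableOn_compact (isCompact_univ.prod isCompact_Icc)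

end Parameters

namespace Ansatz

variable {n q p : ℕ}

/-- The pair of sites of each entangling gate. -/
def sites (C : Ansatz n q p) (t : Fin C.m) : Fin n × Fin n := (C.site₁ t, C.site₂ t)

theorem circuit_eq_circuitOp (C : Ansatz n q p) (V : Fin C.m → U2 q) (θ : Fin p → ℝ) :
    C.circuit V θ = circuitOp C.sites (fun t => paramUnitary (C.post t) θ)
      (fun t => paramUnitary (C.pre t) θ) V := rfl

theorem continuous_circuit (C : Ansatz n q p) :
    Continuous fun z : (Fin C.m → U2 q) × (Fin p → ℝ) => C.circuit z.1 z.2 := by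
  simp only [circuit_eq_circuitOp]
  exact continuous_circuitOp _
    (continuous_pi fun t => (continuous_paramUnitary _).comp continuous_snd)
    (continuous_pi fun t => (continuous_paramUnitary _).comp continuous_snd) continuous_fst

theorem g_eq_evolve [NeZero q] (hq : 2 ≤ q) {M : Fin (q ^ 2) → Matrix (Fin q) (Fin q) ℂ}
    (hM : IsOperatorBasis M) (C : Ansatz n q p) (x : Fin n → Fin (q ^ 2)) :
    C.g M x = evolve C.sites (fun y => ∏ i, ‖M (y i) 0 0‖ ^ 2) x := by
  have (t : Fin C.m) : IsProbabilityMeasure (C.law t) := (C.law_design t).1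
  rw [Ansatz.g, integral_integral_swap (integrable_prod_uniformParams
    (continuous_norm_sq_expectation C.continuous_circuit (tensorOp M x)))]
  simp only [circuit_eq_circuitOp,
    integral_circuitOp hq hM (g := C.sites) C.site_ne _ _ C.law_design, integral_const,
    probReal_univ, one_smul]

end Ansatz

/-! ### Crossing gates and depth -/

namespace Architecture

variable {n : ℕ} (A : Architecture n)

theorem hasLayering_depth : A.HasLayering A.depth :=
  Nat.sInf_mem (s := {k | A.HasLayering k}) ⟨A.m, A.hasLayering_m⟩

/-- A crossing gate is determined by its layer and its site in `S`. -/
theorem gates_le_depth_mul_card (S : Finset (Fin n)) : A.gates S ≤ A.depth * S.card := by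
  obtain ⟨layer, hlayer⟩ := A.hasLayering_depth
  have hlayer_ne {s t : Fin A.m} (hst : s ≠ t) (h : A.Overlap s t) (h' : A.Overlap t s) :
      layer s ≠ layer t := by
    rcases hst.lt_or_gt with hlt | hlt
    · exact (hlayer s t hlt h).ne
    · exact (hlayer t s hlt h').ne'
  let siteIn (t : Fin A.m) : Fin n := if A.site₁ t ∈ S then A.site₁ t else A.site₂ t
  have hsiteIn {t : Fin A.m} (ht : ¬(A.site₁ t ∈ S ↔ A.site₂ t ∈ S)) : siteIn t ∈ S := by
    by_cases h : A.site₁ t ∈ S <;> simp_all [siteIn]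
  have hoverlap {s t : Fin A.m} (h : siteIn s = siteIn t) : A.Overlap s t := by
    simp only [siteIn] at h
    unfold Overlap
    split_ifs at h <;> simp [h]
  calc A.gates S ≤ ((Finset.univ : Finset (Fin A.depth)) ×ˢ S).card :=
        Finset.card_le_card_of_injOn (fun t => (layer t, siteIn t))
          (fun t ht => Finset.mem_coe.mpr
            (Finset.mk_mem_product (Finset.mem_univ _) (hsiteIn (Finset.mem_filter.mp ht).2)))
          fun s _ t _ hst => by
            obtain ⟨hl, hs⟩ := Prod.ext_iff.mp hst
            exact of_not_not fun hne => hlayer_ne hne (hoverlap hs) (hoverlap hs.symm) hl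
    _ = A.depth * S.card := by rw [Finset.card_product, Finset.card_univ, Fintype.card_fin]

theorem depth_pos (i : Fin n) : 0 < A.depth := by
  obtain ⟨layer, -⟩ := A.hasLayering_depth
  obtain ⟨t, -⟩ := A.covers i
  exact (layer t).pos

end Architecture

section LowerBound

theorem IsUnitalOrthogonalBasis.nonzeroAvg_norm_sq_apply_self {ι κ : Type*} [Fintype ι]
    [DecidableEq ι] [Fintype κ] [DecidableEq κ] [Zero κ] {E : κ → Matrix ι ι ℂ}
    (hE : IsUnitalOrthogonalBasis E) (i : ι) (k : κ) :
    nonzeroAvg (fun c => ‖E c i i‖ ^ 2) k =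
      if k = 0 then 1 else 1 / ((Fintype.card ι : ℝ) + 1) := by
  by_cases hk : k = 0
  · simp [hk, hE.map_zero]
  have hcard₀ := hE.card_ne_zero
  have hcard₁ : (Fintype.card ι : ℂ) - 1 ≠ 0 := by
    have : Nontrivial κ := ⟨k, 0, hk⟩
    have : Fintype.card ι ≠ 1 := fun h => Fintype.one_lt_card.ne' (by rw [hE.card_eq, h, one_pow])
    rw [sub_ne_zero]
    exact_mod_cast this
  have h := hE.nonzeroAvg_norm_sq_trace_mul (single i i 1) hk
  simp only [trace_single_mul, one_smul, conjTranspose_single, star_one, single_mul_single_same,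
    mul_one, trace_single_eq_same, norm_one, Complex.ofReal_one, one_pow] at h
  rw [if_neg hk]
  apply Complex.ofReal_injective
  rw [h, show (Fintype.card ι : ℂ) ^ 2 - 1 = (Fintype.card ι - 1) * (Fintype.card ι + 1) by ring]
  push_cast
  field_simp

theorem suppAntitone_pow_card {ι α : Type*} [Fintype ι] [DecidableEq α] [Zero α] {r : ℝ}
    (hr₀ : 0 ≤ r) (hr₁ : r ≤ 1) :
    SuppAntitone fun y : ι → α => r ^ (Finset.univ.filter fun i => y i ≠ 0).card :=
  fun _ _ h => pow_le_pow_of_le_one hr₀ hr₁ <|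
    Finset.card_le_card <| Finset.monotone_filter_right _ fun i _ => mt (h i)

variable {n q p : ℕ}

theorem Ansatz.g_eq_evolve_pow_card_support [NeZero q] (hq : 2 ≤ q)
    {M : Fin (q ^ 2) → Matrix (Fin q) (Fin q) ℂ} (hM : IsOperatorBasis M) (C : Ansatz n q p)
    (x : Fin n → Fin (q ^ 2)) :
    C.g M x = evolve C.sites (fun y => (1 / ((q : ℝ) + 1)) ^ (support y).card) x := by
  have hsite (a : Fin (q ^ 2)) :
      nonzeroAvg (fun b => ‖M b 0 0‖ ^ 2) a = if a = 0 then 1 else 1 / ((q : ℝ) + 1) := by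
    simpa using hM.isUnitalOrthogonalBasis.nonzeroAvg_norm_sq_apply_self 0 a
  rw [C.g_eq_evolve hq hM, evolve_prod C.site_ne C.covers fun _ b => ‖M b 0 0‖ ^ 2]
  simp only [hsite, Finset.prod_ite, Finset.prod_const_one, one_mul, Finset.prod_const]
  rfl

theorem Ansatz.max_le_g [NeZero q] (hq : 2 ≤ q) {M : Fin (q ^ 2) → Matrix (Fin q) (Fin q) ℂ}
    (hM : IsOperatorBasis M) (C : Ansatz n q p) (x : Fin n → Fin (q ^ 2)) :
    max ((1 / ((q : ℝ) + 1)) ^ (support x).card *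
        (1 / ((q : ℝ) ^ 2 + 1)) ^ C.gates (support x)) ((1 / ((q : ℝ) + 1)) ^ n) ≤ C.g M x := by
  have hr₀ : 0 ≤ 1 / ((q : ℝ) + 1) := by positivity
  have hr₁ : 1 / ((q : ℝ) + 1) ≤ 1 := div_le_one_of_le₀ (by simp) (by positivity)
  rw [C.g_eq_evolve_pow_card_support hq hM]
  refine max_le ?_ (le_evolve _ (fun y => ?_) x)
  · have hgates : (∏ t, if (x (C.sites t).1 ≠ 0 ↔ x (C.sites t).2 ≠ 0) then 1
        else 1 / ((Fintype.card (Fin (q ^ 2)) : ℝ) + 1)) =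
          (1 / ((q : ℝ) ^ 2 + 1)) ^ C.gates (support x) := by
      rw [Finset.prod_ite, Finset.prod_const_one, one_mul, Finset.prod_const, Architecture.gates]
      simp only [support, Finset.mem_filter, Finset.mem_univ, true_and, Ansatz.sites,
        Fintype.card_fin, Nat.cast_pow]
      congr
    rw [mul_comm, ← hgates]
    exact (suppAntitone_pow_card hr₀ hr₁).mul_le_evolve (fun y => pow_nonneg hr₀ _) C.sites x
  · exact pow_le_pow_of_le_one hr₀ hr₁ (card_finset_fin_le _)

end LowerBound

theorem rpow_neg_le_pow_mul_pow {q : ℝ} (hq : 2 ≤ q) {d s k : ℕ} (hs : s ≤ d * s)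
    (hk : k ≤ d * s) :
    q ^ (-(5 * (d : ℝ) * (s : ℝ))) ≤ (1 / (q + 1)) ^ s * (1 / (q ^ 2 + 1)) ^ k := by
  have hq₀ : 0 < q := by linarith
  have hq₁ : 1 ≤ q := by linarith
  have hs' : (q + 1) ^ s ≤ q ^ (2 * (d * s)) := by
    calc (q + 1) ^ s ≤ (q ^ 2) ^ s := by gcongr; nlinarith
      _ = q ^ (2 * s) := (pow_mul _ _ _).symm
      _ ≤ q ^ (2 * (d * s)) := pow_le_pow_right₀ hq₁ (by omega)
  have hk' : (q ^ 2 + 1) ^ k ≤ q ^ (3 * (d * s)) := by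
    calc (q ^ 2 + 1) ^ k ≤ (q ^ 3) ^ k := by
          gcongr
          nlinarith [mul_nonneg (sq_nonneg q) (sub_nonneg.mpr hq)]
      _ = q ^ (3 * k) := (pow_mul _ _ _).symm
      _ ≤ q ^ (3 * (d * s)) := pow_le_pow_right₀ hq₁ (by omega)
  calc q ^ (-(5 * (d : ℝ) * (s : ℝ))) = (q ^ (2 * (d * s)) * q ^ (3 * (d * s)))⁻¹ := by
        rw [Real.rpow_neg hq₀.le, ← pow_add, ← Real.rpow_natCast]
        push_cast
        ring_nf
    _ ≤ ((q + 1) ^ s * (q ^ 2 + 1) ^ k)⁻¹ := inv_anti₀ (by positivity) (by gcongr)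
    _ = (1 / (q + 1)) ^ s * (1 / (q ^ 2 + 1)) ^ k := by
        rw [one_div, one_div, inv_pow, inv_pow, mul_inv]

theorem corollary1 :
    ∃ K : ℝ, 0 < K ∧
      ∀ (q : ℕ) [NeZero q], 2 ≤ q →
      ∀ (M : Fin (q ^ 2) → Matrix (Fin q) (Fin q) ℂ), IsOperatorBasis M →
      ∀ (n p : ℕ) (C : Ansatz n q p) (x : Fin n → Fin (q ^ 2)),
        max ((1 / ((q : ℝ) + 1)) ^ (support x).card *
              (1 / ((q : ℝ) ^ 2 + 1)) ^ C.gates (support x))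
            ((1 / ((q : ℝ) + 1)) ^ n) ≤ C.g M x ∧
        C.gates (support x) ≤ C.depth * (support x).card ∧
        max ((q : ℝ) ^ (-(K * (C.depth : ℝ) * ((support x).card : ℝ))))
            ((1 / ((q : ℝ) + 1)) ^ n) ≤ C.g M x := by
  refine ⟨5, by norm_num, fun q _ hq M hM n p C x => ?_⟩
  have hg := C.max_le_g hq hM x
  have hgates := C.gates_le_depth_mul_card (support x)
  have hsupp : (support x).card ≤ C.depth * (support x).card := by
    rcases (support x).eq_empty_or_nonempty with h | ⟨i, -⟩
    · simp [h]
    · exact Nat.le_mul_of_pos_left _ (C.depth_pos i)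
  exact ⟨hg, hgates, max_le_iff.mpr
    ⟨(rpow_neg_le_pow_mul_pow (by exact_mod_cast hq) hsupp hgates).trans (max_le_iff.mp hg).1,
      (max_le_iff.mp hg).2⟩⟩
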